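/- Let $f_1,\dots,f_p$ be smooth vector fields on $\mathbb{R}^d$ vanishing at the origin, and let $V:\mathbb{R}^d\to[0,\infty)$ be a smooth common weak Lyapunov function: $V(0)=0$, $V(x)>0$ for $x\neq 0$, and $L_{f_i}V(x)=DV(x)\cdot f_i(x)\le 0$ for all $x\in\mathbb{R}^d$ and all $i$. An input is a right-continuous function $u:[0,\infty)\to\{1,\dots,p\}$ which is piecewise constant: there are times $0=a_0<a_1<a_2<\cdots$ with $a_n\to+\infty$ such that $u$ is constant on each $[a_n,a_{n+1})$. For an input $u$ and $x\in\mathbb{R}^d$, let $\Phi_u(\cdot,x)$ denote the solution of $\dot y=f_{u(t)}(y)$, $y(0)=x$, and, when it is defined on $[0,\infty)$, let $\Omega_u(x)$ be the set of all limits of sequences $(\Phi_u(t_k,x))_{k\ge 0}$, where $(t_k)_{k\ge 0}$ is a sequence of nonnegative times increasing to $+\infty$. Let $\mathcal{W}$ be a connected neighborhood of the origin such that for every $x\in\mathcal{W}$ and every input $u$ the solution $\Phi_u(\cdot,x)$ is defined and bounded on $[0,\infty)$. Set $$\mathcal{K}_i=\{x\in\mathbb{R}^d:\ L_{f_i}V(x)=0\},\qquad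 J_u=\{i\in\{1,\dots,p\}:\ m(\{t\ge 0:\ u(t)=i\})=+\infty\},$$ where $m$ is the Lebesgue measure. Then for every $x\in\mathcal{W}$ and every input $u$, $$\Omega_u(x)\subseteq\bigcup_{i\in J_u}\mathcal{K}_i.$$ -/

import Mathlib

open Set Filter Topology MeasureTheory
open scoped ContDiff

namespace SwitchedSystem

/-- The state space `ℝ^d` with its Euclidean structure. -/
abbrev State (d : ℕ) : Type := EuclideanSpace ℝ (Fin d)

/-- The Lie derivative `(L_g V)(x) = DV(x) · g(x)` of a function `V` along a vector field `g`. -/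
noncomputable def lieDerivative {d : ℕ} (g : State d → State d) (V : State d → ℝ)
    (x : State d) : ℝ :=
  fderiv ℝ V x (g x)

/-- A smooth positive definite function whose Lie derivative along every `f i` is nonpositive. -/
structure IsCommonWeakLyapunov {d p : ℕ} (f : Fin p → State d → State d)
    (V : State d → ℝ) : Prop where
  smooth : ContDiff ℝ ∞ V
  map_zero : V 0 = 0
  pos : ∀ x, x ≠ 0 → 0 < V x
  lie_nonpos : ∀ i x, lieDerivative (f i) V x ≤ 0

/-- An input (switching signal): a function on `[0, ∞)` with values in the set of indices for
which there are times `0 = a 0 < a 1 < ⋯` tending to `+∞` such that it is constant on each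
`[a n, a (n + 1))`. The values at negative times are irrelevant. -/
def IsInput {p : ℕ} (u : ℝ → Fin p) : Prop :=
  ∃ a : ℕ → ℝ, a 0 = 0 ∧ StrictMono a ∧ Tendsto a atTop atTop ∧
    ∀ n, ∀ t ∈ Ico (a n) (a (n + 1)), u t = u (a n)

/-- `φ` is a solution on `[0, ∞)` of `ẋ = f_{u(t)}(x)` with initial condition `x`. It is
continuous, and since `u` is right-continuous and piecewise constant, the equation is expressed
by the right derivative, at every time `t ≥ 0` (between two switching times this amounts to the
equation for the ordinary derivative). -/
structure IsSolution {d p : ℕ} (f : Fin p → State d → State d) (u : ℝ → Fin p)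
    (x : State d) (φ : ℝ → State d) : Prop where
  initial : φ 0 = x
  continuousOn : ContinuousOn φ (Ici 0)
  hasDeriv : ∀ t, 0 ≤ t → HasDerivWithinAt φ (f (u t) (φ t)) (Ici t) t

/-- The set `Ω_u(x)` of the limits of sequences `Φ_u(t_k, x)`, where `(t_k)` is a sequence of
nonnegative times increasing to `+∞` and `Φ_u(·, x)` is the solution with input `u` starting at
`x` (which is unique on `[0, ∞)` for smooth vector fields). -/
def omegaLimitSet {d p : ℕ} (f : Fin p → State d → State d) (u : ℝ → Fin p)
    (x : State d) : Set (State d) :=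
  {l | ∃ φ : ℝ → State d, IsSolution f u x φ ∧
    ∃ t : ℕ → ℝ, StrictMono t ∧ (∀ k, 0 ≤ t k) ∧ Tendsto t atTop atTop ∧
      Tendsto (fun k => φ (t k)) atTop (𝓝 l)}

/-- A connected neighborhood `W` of the origin such that for every `x ∈ W` and every input the
solution starting at `x` is defined for all nonnegative times and forward bounded. -/
structure IsForwardBoundedNeighborhood {d p : ℕ} (f : Fin p → State d → State d)
    (W : Set (State d)) : Prop where
  mem_nhds : W ∈ 𝓝 (0 : State d)
  connected : IsConnected W
  forward_bounded : ∀ x ∈ W, ∀ u : ℝ → Fin p, IsInput u →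
    ∃ φ : ℝ → State d, IsSolution f u x φ ∧ Bornology.IsBounded (φ '' Ici 0)

/-- The set `K = {L_g V = 0}` where `g` is tangent to the level sets of `V`. -/
def tangencySet {d : ℕ} (g : State d → State d) (V : State d → ℝ) : Set (State d) :=
  {x | lieDerivative g V x = 0}

/-- The set `J_u` of the indices `i` such that `{t ≥ 0 : u t = i}` has infinite Lebesgue
measure. -/
def persistentIndices {p : ℕ} (u : ℝ → Fin p) : Set (Fin p) :=
  {i | volume {t : ℝ | 0 ≤ t ∧ u t = i} = ⊤}

end SwitchedSystem

namespace SwitchedSystem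

/-! Suppose a limit point `l` has `L_{f_i} V(l) < 0` for every persistent `i`. Near `l` these
derivatives stay below some `-δ` and all fields are bounded by `M`, so each visit near `l` lasts at
least `r / M` (`IsSolution.dist_le_of_bound`). Over that time `V` drops by at least `δ * (r / M)`,
less `δ` times the time spent on non-persistent indices. That time tends to `0` along the visits,
since its total is finite, whereas `V` converges along the solution: a contradiction. -/

lemma IsInput.measurableSet_preimage {p : ℕ} {u : ℝ → Fin p} (hu : IsInput u)
    (S : Set (Fin p)) : MeasurableSet {t : ℝ | 0 ≤ t ∧ u t ∈ S} := by
  obtain ⟨a, ha0, hmono, htop, hconst⟩ := hu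
  have hset : {t : ℝ | 0 ≤ t ∧ u t ∈ S} =
      ⋃ n, ⋃ _ : u (a n) ∈ S, Ico (a n) (a (n + 1)) := by
    ext t
    simp only [mem_ofPred_eq, mem_iUnion, exists_prop]
    constructor
    · rintro ⟨h0, hS⟩
      have hex : ∃ n, t < a n := (htop.eventually_gt_atTop t).exists
      classical
      obtain ⟨n, hn⟩ : ∃ n, Nat.find hex = n + 1 := by
        refine Nat.exists_eq_succ_of_ne_zero fun h => ?_
        have := Nat.find_spec hex
        rw [h, ha0] at this
        linarith
      have hlt : t < a (n + 1) := hn ▸ Nat.find_spec hex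
      have hle : a n ≤ t := not_lt.1 (Nat.find_min hex (by omega))
      exact ⟨n, hconst n t ⟨hle, hlt⟩ ▸ hS, hle, hlt⟩
    · rintro ⟨n, hS, hn⟩
      refine ⟨?_, (hconst n t hn).symm ▸ hS⟩
      have := hmono.monotone (Nat.zero_le n)
      linarith [hn.1]
  rw [hset]
  exact MeasurableSet.iUnion fun _ => MeasurableSet.iUnion fun _ => measurableSet_Ico

lemma volume_nonpersistent_lt_top {p : ℕ} (u : ℝ → Fin p) :
    volume {t : ℝ | 0 ≤ t ∧ u t ∈ (persistentIndices u)ᶜ} < ⊤ := by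
  have hset : {t : ℝ | 0 ≤ t ∧ u t ∈ (persistentIndices u)ᶜ} =
      ⋃ i ∈ (persistentIndices u)ᶜ, {t : ℝ | 0 ≤ t ∧ u t = i} := by
    ext t
    simp
  rw [hset]
  exact measure_biUnion_lt_top (toFinite _) fun i hi => lt_top_iff_ne_top.2 hi

section

variable {d p : ℕ} {f : Fin p → State d → State d} {V : State d → ℝ} {u : ℝ → Fin p}
  {x : State d} {φ : ℝ → State d}

lemma IsCommonWeakLyapunov.nonneg (hV : IsCommonWeakLyapunov f V) (y : State d) : 0 ≤ V y := by
  rcases eq_or_ne y 0 with rfl | hy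
  · exact hV.map_zero.ge
  · exact (hV.pos y hy).le

lemma continuous_lieDerivative {g : State d → State d} (hg : Continuous g)
    (hV : ContDiff ℝ ∞ V) : Continuous (lieDerivative g V) :=
  (hV.continuous_fderiv (by simp)).clm_apply hg

lemma IsSolution.hasDerivWithinAt_comp (hφ : IsSolution f u x φ) (hV : ContDiff ℝ ∞ V)
    {t : ℝ} (ht : 0 ≤ t) :
    HasDerivWithinAt (fun s => V (φ s)) (lieDerivative (f (u t)) V (φ t)) (Ici t) t :=
  ((hV.differentiable (by simp) (φ t)).hasFDerivAt).comp_hasDerivWithinAt t (hφ.hasDeriv t ht)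

/-- `V ∘ φ` has only a right derivative at switching times; comparing with an integrable majorant
`h` avoids integrating that derivative. -/
lemma IsSolution.sub_le_integral (hφ : IsSolution f u x φ) (hV : ContDiff ℝ ∞ V)
    {a b : ℝ} (ha : 0 ≤ a) (hab : a ≤ b) {h : ℝ → ℝ} (hint : IntegrableOn h (Icc a b))
    (hle : ∀ t ∈ Ico a b, lieDerivative (f (u t)) V (φ t) ≤ h t) :
    V (φ b) - V (φ a) ≤ ∫ t in a..b, h t :=
  intervalIntegral.sub_le_integral_of_hasDeriv_right_of_le hab
    (hV.continuous.comp_continuousOn (hφ.continuousOn.mono fun _ ht => ha.trans ht.1))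
    (fun _ ht => (hφ.hasDerivWithinAt_comp hV (ha.trans ht.1.le)).mono Ioi_subset_Ici_self)
    hint fun t ht => hle t (Ioo_subset_Ico_self ht)

lemma IsSolution.exists_tendsto_lyapunov (hφ : IsSolution f u x φ)
    (hV : IsCommonWeakLyapunov f V) : ∃ c, Tendsto (fun t => V (φ t)) atTop (𝓝 c) := by
  -- Freezing time at `0` for negative `t` makes the function antitone on all of `ℝ`.
  have hanti : Antitone fun t => V (φ (max t 0)) := fun s t hst => by
    have := hφ.sub_le_integral hV.smooth (le_max_right s 0) (max_le_max_right 0 hst)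
      (h := fun _ => 0) (integrableOn_zero) fun t _ => hV.lie_nonpos _ _
    simpa using this
  have hlim := tendsto_atTop_ciInf hanti ⟨0, by rintro _ ⟨t, rfl⟩; exact hV.nonneg _⟩
  refine ⟨_, hlim.congr' ?_⟩
  filter_upwards [eventually_ge_atTop 0] with t ht
  rw [max_eq_left ht]

/-- A solution that is `r`-close to `l` remains `2 r`-close to `l` for a time `r / M`, where `M`
bounds the vector fields near `l`. -/
lemma IsSolution.dist_le_of_bound (hφ : IsSolution f u x φ) {l : State d} {r M : ℝ} (hM : 0 < M)
    (hf : ∀ i, ∀ y ∈ Metric.closedBall l (2 * r), ‖f i y‖ < M) {a : ℝ} (ha : 0 ≤ a)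
    (hal : dist (φ a) l ≤ r) : ∀ t ∈ Icc a (a + r / M), dist (φ t) l ≤ 2 * r := by
  have hle : ∀ t ≤ a + r / M, r + M * (t - a) ≤ 2 * r := fun t ht => by
    have : M * (t - a) ≤ M * (r / M) := by gcongr; linarith
    rw [mul_div_cancel₀ _ hM.ne'] at this
    linarith
  -- The speed bound is needed only where the distance to `l` equals the barrier `r + M * (t - a)`;
  -- there `φ t` is still in the ball of radius `2 * r`, so no bootstrap is needed.
  have key := image_norm_le_of_norm_deriv_right_lt_deriv_boundary
    (f := fun t => φ t - l) (f' := fun t => f (u t) (φ t)) (a := a) (b := a + r / M)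
    (B := fun t => r + M * (t - a)) (B' := fun _ => M)
    ((hφ.continuousOn.mono fun _ ht => ha.trans ht.1).sub continuousOn_const)
    (fun t ht => (hφ.hasDeriv t (ha.trans ht.1)).sub_const l)
    (by simpa [dist_eq_norm] using hal)
    (fun t => by simpa using (((hasDerivAt_id t).sub_const a).const_mul M).const_add r)
    (fun t ht heq => hf _ _ (by
      rw [Metric.mem_closedBall, dist_eq_norm, heq]
      exact hle t ht.2.le))
  intro t ht
  rw [dist_eq_norm]
  exact (key ht).trans (hle t ht.2)

/-- There are finitely many indices, so one `δ`, one `M` and one radius serve them all. -/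
lemma exists_uniform_bounds_near (hf : ∀ i, Continuous (f i)) (hV : ContDiff ℝ ∞ V)
    {S : Set (Fin p)} {l : State d} (hl : ∀ i ∈ S, lieDerivative (f i) V l < 0) :
    ∃ δ > 0, ∃ M > 0, ∃ r > 0, ∀ y ∈ Metric.closedBall l (2 * r),
      (∀ i, ‖f i y‖ < M) ∧ ∀ i ∈ S, lieDerivative (f i) V y < -δ := by
  obtain ⟨δ, hδl, hδ⟩ : ∃ δ : ℝ, (∀ i, i ∈ S → lieDerivative (f i) V l < -δ) ∧ 0 < δ := by
    refine Eventually.exists (f := 𝓝[>] (0 : ℝ)) (Eventually.and ?_ self_mem_nhdsWithin)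
    refine eventually_all.2 fun i => eventually_imp_distrib_left.2 fun hi => ?_
    refine nhdsWithin_le_nhds ?_
    have hpos : 0 < -lieDerivative (f i) V l := neg_pos.2 (hl i hi)
    filter_upwards [Iio_mem_nhds hpos] with δ hδ
    linarith [mem_Iio.1 hδ]
  obtain ⟨M, hMl, hM⟩ : ∃ M : ℝ, (∀ i, ‖f i l‖ < M) ∧ 0 < M :=
    ((eventually_all.2 fun i => eventually_gt_atTop ‖f i l‖).and
      (eventually_gt_atTop (0 : ℝ))).exists
  have hnear : ∀ᶠ y in 𝓝 l,
      (∀ i, ‖f i y‖ < M) ∧ ∀ i, i ∈ S → lieDerivative (f i) V y < -δ := by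
    refine (eventually_all.2 fun i => ?_).and
      (eventually_all.2 fun i => eventually_imp_distrib_left.2 fun hi => ?_)
    · exact (hf i).norm.continuousAt.eventually_lt_const (hMl i)
    · exact (continuous_lieDerivative (hf i) hV).continuousAt.eventually_lt_const (hδl i hi)
  obtain ⟨ε, hε, hball⟩ := Metric.nhds_basis_closedBall.eventually_iff.1 hnear
  refine ⟨δ, hδ, M, hM, ε / 2, by positivity, fun y hy => hball ?_⟩
  rwa [mul_div_cancel₀ _ two_ne_zero] at hy

lemma omegaLimitSet_subset_iUnion_tangencySet (hf : ∀ i, Continuous (f i))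
    (hV : IsCommonWeakLyapunov f V) (hu : IsInput u) :
    omegaLimitSet f u x ⊆ ⋃ i ∈ persistentIndices u, tangencySet (f i) V := by
  rintro l ⟨φ, hφ, t, -, ht0, httop, htl⟩
  by_contra hl
  have hneg : ∀ i ∈ persistentIndices u, lieDerivative (f i) V l < 0 := fun i hi =>
    lt_of_le_of_ne (hV.lie_nonpos i l) fun h => hl (mem_biUnion hi h)
  obtain ⟨δ, hδ, M, hM, r, hr, hbd⟩ := exists_uniform_bounds_near hf hV.smooth hneg
  set A := {t : ℝ | 0 ≤ t ∧ u t ∈ (persistentIndices u)ᶜ} with hA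
  have hAint : Integrable (A.indicator fun _ => (1 : ℝ)) :=
    (integrable_indicator_iff (hu.measurableSet_preimage _)).2
      (integrableOn_const (volume_nonpersistent_lt_top u).ne)
  have hdecr : ∀ᶠ k in atTop, V (φ (t k + r / M)) - V (φ (t k)) ≤
      -δ * (r / M) + δ * ((∫ s in (0)..(t k + r / M), A.indicator (fun _ => (1 : ℝ)) s) -
        ∫ s in (0)..(t k), A.indicator (fun _ => (1 : ℝ)) s) := by
    filter_upwards [htl.eventually (Metric.closedBall_mem_nhds l hr)] with k hk
    have hstay := hφ.dist_le_of_bound hM (fun i y hy => (hbd y hy).1 i) (ht0 k) hk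
    -- The majorant is `-δ` off `A`, where the active index is persistent, and `0` on `A`, where
    -- only the weak Lyapunov inequality is available.
    have hle := hφ.sub_le_integral hV.smooth (ht0 k)
      (le_add_of_nonneg_right (by positivity : 0 ≤ r / M))
      (h := fun s => -δ + δ * A.indicator (fun _ => (1 : ℝ)) s)
      ((integrableOn_const (by simp)).add (hAint.const_mul δ).integrableOn) ?_
    · rw [intervalIntegral.integral_add (by simp) (hAint.const_mul δ).intervalIntegrable,
        intervalIntegral.integral_const_mul, intervalIntegral.integral_const] at hle
      rw [intervalIntegral.integral_interval_sub_left hAint.intervalIntegrable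
        hAint.intervalIntegrable]
      simpa [mul_comm] using hle
    · intro s hs
      by_cases hsJ : u s ∈ persistentIndices u
      · have hsA : s ∉ A := fun h => h.2 hsJ
        simpa [hsA] using ((hbd _ (hstay s ⟨hs.1, hs.2.le⟩)).2 _ hsJ).le
      · have hsA : s ∈ A := ⟨(ht0 k).trans hs.1, hsJ⟩
        simpa [hsA] using hV.lie_nonpos (u s) (φ s)
  have httop' : Tendsto (fun k => t k + r / M) atTop atTop :=
    tendsto_atTop_add_const_right _ _ httop
  obtain ⟨c, hc⟩ := hφ.exists_tendsto_lyapunov hV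
  have hI := fun s (hs : Tendsto s (atTop : Filter ℕ) atTop) =>
    intervalIntegral_tendsto_integral_Ioi 0 hAint.integrableOn hs
  -- Both integrals tend to the integral over `(0, ∞)`, so the limit of `hdecr` amounts to `0 ≤ -δ *
  -- (r / M)`.
  have hlim := le_of_tendsto_of_tendsto ((hc.comp httop').sub (hc.comp httop))
    ((((hI _ httop').sub (hI _ httop)).const_mul δ).const_add (-δ * (r / M))) hdecr
  have : 0 < δ * (r / M) := by positivity
  linarith

end

end SwitchedSystem

theorem mainTheorem3 {d p : ℕ}
    (f : Fin p → SwitchedSystem.State d → SwitchedSystem.State d)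
    (hf : ∀ i, ContDiff ℝ ∞ (f i))
    (hf0 : ∀ i, f i 0 = 0)
    (V : SwitchedSystem.State d → ℝ)
    (hV : SwitchedSystem.IsCommonWeakLyapunov f V)
    (W : Set (SwitchedSystem.State d))
    (hW : SwitchedSystem.IsForwardBoundedNeighborhood f W)
    (x : SwitchedSystem.State d) (hx : x ∈ W)
    (u : ℝ → Fin p) (hu : SwitchedSystem.IsInput u) :
    SwitchedSystem.omegaLimitSet f u x ⊆
      ⋃ i ∈ SwitchedSystem.persistentIndices u, SwitchedSystem.tangencySet (f i) V :=
  SwitchedSystem.omegaLimitSet_subset_iUnion_tangencySet (fun i => (hf i).continuous) hV hu
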